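/- **Theorem 3.3 (General Wolstenholme-like Congruence).** For integers $j,n\ge 0$ let $$H(\{1\}^j;n)=\sum_{n\ge i_1>\cdots>i_j\ge 1}\frac{1}{i_1\cdots i_j},$$ with $H(\{1\}^0;n)=1$ and $H(\{1\}^j;n)=0$ for $j>n$. Let $B_m$ denote the Bernoulli numbers. For a prime $p$, an integer $m\ge 0$ and $x,y\in\mathbb{Q}$, write $x\equiv y\pmod{p^m}$ if $x-y=p^m r$ for some $r\in\mathbb{Q}$ whose denominator in lowest terms is not divisible by $p$. Let $k$ be an integer, let $c_0,c_1,\ldots\in\mathbb{Q}$, and for $j\ge 0$ put $$b_j=(k-1)^j+c_j+(-1)^{j+1}\sum_{i=0}^{j}\binom{j}{i}c_i ,$$ where $0^0=1$. Let $p$ be an odd prime which does not divide the denominator of any $c_i$, let $N\ge 0$ be an integer, and define $$E_N=\binom{kp-1}{p-1}-\sum_{j=0}^{N}b_j\,p^j\,H(\{1\}^j;p-1),$$ where $\binom{kp-1}{p-1}=\frac{1}{(p-1)!}\prod_{i=1}^{p-1}(kp-i)$ for every integer $k$. 1. If $0\le N\le p-4$, then $$E_N\equiv\frac{-B_{p-3-N}}{N+3}\left(\frac{N+2}{2}\,b_{N+1}+b_{N+2}\right)p^{N+3}\pmod{p^{N+4}}\quad\text{when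 } N \text{ is even},$$ $$E_N\equiv\frac{-B_{p-2-N}}{N+2}\,b_{N+1}\,p^{N+2}\pmod{p^{N+3}}\quad\text{when } N \text{ is odd}.$$ 2. If $N=p-3$, then $E_N\equiv\left(\frac{b_{N+1}}{2}-b_{N+2}\right)p^{N+2}\pmod{p^{N+3}}$. 3. If $N=p-2$, then $E_N\equiv -b_{N+1}\,p^{N+1}\pmod{p^{N+2}}$. 4. If $N\ge p-1$, then $E_N=0$. In particular, $\binom{kp-1}{p-1}\equiv\sum_{j=0}^{N}b_j\,p^j\,H(\{1\}^j;p-1)$ modulo $p^{N+3}$ if $N\le p-4$ and $N$ is even, modulo $p^{N+2}$ if $N\le p-4$ and $N$ is odd, modulo $p^{N+2}$ if $N=p-3$, modulo $p^{N+1}$ if $N=p-2$, and with equality if $N\ge p-1$. -/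

import Mathlib

/-- The multiple harmonic sum `H(l; n)` of a composition `l = {l₁, …, l_j}`: the sum over all
strictly decreasing sequences `n ≥ i₁ > ⋯ > i_j ≥ 1` of `1 / (i₁ ^ l₁ ⋯ i_j ^ l_j)`.
It is `1` for the empty composition and `0` if `n < j`. -/
def multipleHarmonicSum {j : ℕ} (l : Fin j → ℕ) (n : ℕ) : ℚ :=
  ∑ i ∈ (Fintype.piFinset fun _ : Fin j => Finset.Icc 1 n) with ∀ s t, s < t → i t < i s,
    1 / ∏ t, (i t : ℚ) ^ l t

/-- The elementary symmetric multiple harmonic sum `H({1}^j; n)`. -/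
def harmonicOnes (j n : ℕ) : ℚ :=
  multipleHarmonicSum (fun _ : Fin j => 1) n

/-- `b_j = (k-1)^j + c_j + (-1)^(j+1) ∑_{i=0}^j C(j,i) c_i`. -/
def wolstenholmeCoeff (k : ℤ) (c : ℕ → ℚ) (j : ℕ) : ℚ :=
  ((k : ℚ) - 1) ^ j + c j
    + (-1) ^ (j + 1) * ∑ i ∈ Finset.range (j + 1), (j.choose i : ℚ) * c i

/-- The truncated sum `∑_{j=0}^N b_j p^j H({1}^j; p-1)`. -/
def wolstenholmeSum (k : ℤ) (c : ℕ → ℚ) (p N : ℕ) : ℚ :=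
  ∑ j ∈ Finset.range (N + 1),
    wolstenholmeCoeff k c j * (p : ℚ) ^ j * harmonicOnes j (p - 1)

/-- The binomial coefficient `C(kp-1, p-1) = (kp-1)(kp-2)⋯(kp-(p-1)) / (p-1)!`, for an arbitrary
integer `k` (so `kp-1` may be negative). -/
def wolstenholmeBinom (k : ℤ) (p : ℕ) : ℤ :=
  Ring.choose (k * (p : ℤ) - 1) (p - 1)

/-- The truncation error `E_N`. -/
def wolstenholmeError (k : ℤ) (c : ℕ → ℚ) (p N : ℕ) : ℚ :=
  (wolstenholmeBinom k p : ℚ) - wolstenholmeSum k c p N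

/-- Congruence of rational numbers `x ≡ y (mod p^m)`: the difference is `p^m` times a rational
number whose denominator (in lowest terms) is not divisible by `p`. -/
def RatModPow (p m : ℕ) (x y : ℚ) : Prop :=
  ∃ r : ℚ, ¬ p ∣ r.den ∧ x - y = (p : ℚ) ^ m * r

/-!
Write `H_j` for `H({1}^j; p - 1)`. The polynomial `∏_{i<p} (1 + x / i) = ∑_j H_j x ^ j` takes at
`x = (k - 1) p` the value `C(kp - 1, p - 1)`, and for odd `p` it is invariant under `x ↦ -p - x`.
Comparing coefficients, the invariance gives, for every `i`,
`p ^ i H_i = ∑_j (-1) ^ j C(j, i) p ^ j H_j` (`harmonicOnes_reflection`), which is exactly what makes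
the contribution of the `c_i` to `∑_j b_j p ^ j H_j` vanish. Since `H_j = 0` for `j ≥ p`, the full
sum equals the binomial coefficient (`wolstenholmeBinom_eq_sum`), and the truncation error `E_N` is
the tail `∑_{N<j<p} b_j p ^ j H_j`.

It remains to know the first terms of the tail to sufficient `p`-adic precision. As
`(p - 1)! H_n = e_{p-1-n}`, the elementary symmetric function of `1, …, p - 1`, Newton's identities
reduce this to power sums, which Faulhaber's formula gives modulo `p ^ 2` in terms of Bernoulli
numbers. The outcome is `p ∣ H_n` for `1 ≤ n ≤ p - 2` (`powDvd_one_harmonicOnes`) and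
`H_n ≡ -p B_{p-1-n} / (n + 1) (mod p ^ 2)` for even `n` with `2 ≤ n ≤ p - 3`
(`powDvd_two_harmonicOnes_even`). For odd `n ≤ p - 4` the reflection formula yields
`H_n ≡ (n + 1) / 2 * p H_{n+1} (mod p ^ 3)` (`powDvd_three_harmonicOnes_odd`). The two
last sums are `H_{p-1} = 1 / (p - 1)! ≡ -1 (mod p)`, by Wilson's theorem, and
`H_{p-2} ≡ p / 2 (mod p ^ 2)`, by reflection.
-/

/-! ### Divisibility of rational numbers by powers of a prime -/

/-- `PowDvd p m x`: the rational number `x` lies in `p ^ m ℤ₍ₚ₎`, that is, `x` is `p ^ m` times a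
rational number whose denominator is prime to `p`. Thus `RatModPow p m x y` is, definitionally,
`PowDvd p m (x - y)`. -/
def PowDvd (p m : ℕ) (x : ℚ) : Prop :=
  ∃ r : ℚ, ¬ p ∣ r.den ∧ x = (p : ℚ) ^ m * r

namespace PowDvd

variable {p : ℕ}

theorem of_den {x : ℚ} (h : ¬ p ∣ x.den) : PowDvd p 0 x := ⟨x, h, by simp⟩

theorem intCast (hp : p.Prime) (z : ℤ) : PowDvd p 0 (z : ℚ) :=
  of_den (by simpa using hp.one_lt.ne')

theorem neg_one_pow (hp : p.Prime) (n : ℕ) : PowDvd p 0 ((-1) ^ n) :=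
  mod_cast intCast hp ((-1) ^ n)

theorem natCast (hp : p.Prime) (n : ℕ) : PowDvd p 0 (n : ℚ) := by
  simpa using intCast hp (n : ℤ)

theorem zero (hp : p.Prime) (m : ℕ) : PowDvd p m 0 :=
  ⟨0, by simpa using hp.one_lt.ne', by simp⟩

theorem prime_pow (hp : p.Prime) (m : ℕ) : PowDvd p m ((p : ℚ) ^ m) :=
  ⟨1, by simpa using hp.one_lt.ne', by simp⟩

theorem mul (hp : p.Prime) {m n : ℕ} {x y : ℚ} (hx : PowDvd p m x) (hy : PowDvd p n y) :
    PowDvd p (m + n) (x * y) := by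
  obtain ⟨r, hr, rfl⟩ := hx
  obtain ⟨s, hs, rfl⟩ := hy
  refine ⟨r * s, fun h => ?_, by ring⟩
  rcases hp.dvd_mul.1 (h.trans (Rat.mul_den_dvd r s)) with h | h
  exacts [hr h, hs h]

theorem add (hp : p.Prime) {m : ℕ} {x y : ℚ} (hx : PowDvd p m x) (hy : PowDvd p m y) :
    PowDvd p m (x + y) := by
  obtain ⟨r, hr, rfl⟩ := hx
  obtain ⟨s, hs, rfl⟩ := hy
  refine ⟨r + s, fun h => ?_, by ring⟩
  rcases hp.dvd_mul.1 (h.trans (Rat.add_den_dvd r s)) with h | h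
  exacts [hr h, hs h]

theorem neg {m : ℕ} {x : ℚ} (hx : PowDvd p m x) : PowDvd p m (-x) := by
  obtain ⟨r, hr, rfl⟩ := hx
  exact ⟨-r, by simpa using hr, by ring⟩

theorem sub (hp : p.Prime) {m : ℕ} {x y : ℚ} (hx : PowDvd p m x) (hy : PowDvd p m y) :
    PowDvd p m (x - y) := by
  simpa [sub_eq_add_neg] using hx.add hp hy.neg

theorem mono (hp : p.Prime) {m n : ℕ} (h : m ≤ n) {x : ℚ} (hx : PowDvd p n x) :
    PowDvd p m x := by
  obtain ⟨r, hr, rfl⟩ := hx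
  obtain ⟨d, rfl⟩ := Nat.exists_eq_add_of_le h
  obtain ⟨s, hs, h⟩ := mul hp (natCast hp (p ^ d)) (of_den hr)
  refine ⟨s, hs, ?_⟩
  rw [pow_add, mul_assoc]
  congr 1
  simpa using h

theorem sum (hp : p.Prime) {m : ℕ} {ι : Type*} (s : Finset ι) {f : ι → ℚ}
    (h : ∀ i ∈ s, PowDvd p m (f i)) : PowDvd p m (∑ i ∈ s, f i) :=
  Finset.sum_induction _ (PowDvd p m) (fun _ _ hx hy => hx.add hp hy) (zero hp m) h

theorem mul_left (hp : p.Prime) {m : ℕ} {x y : ℚ} (hx : PowDvd p 0 x) (hy : PowDvd p m y) :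
    PowDvd p m (x * y) := by
  simpa using hx.mul hp hy

theorem mul_right (hp : p.Prime) {m : ℕ} {x y : ℚ} (hx : PowDvd p m x) (hy : PowDvd p 0 y) :
    PowDvd p m (x * y) := by
  simpa using hx.mul hp hy

theorem inv_natCast {n : ℕ} (h : ¬ p ∣ n) : PowDvd p 0 (n : ℚ)⁻¹ := by
  have hn : n ≠ 0 := by rintro rfl; exact h (dvd_zero p)
  exact of_den (by simpa [Rat.inv_natCast_den, hn] using h)

/-- Multiplication by an integer prime to `p` can be cancelled. -/
theorem of_natCast_mul (hp : p.Prime) {m n : ℕ} (h : ¬ p ∣ n) {x : ℚ}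
    (hx : PowDvd p m (n * x)) : PowDvd p m x := by
  have hn : (n : ℚ) ≠ 0 := by
    rintro h0
    exact h (by simp [Nat.cast_eq_zero.1 h0])
  simpa [hn] using (inv_natCast h).mul_left hp hx

theorem of_intCast_dvd (hp : p.Prime) {z : ℤ} (h : (p : ℤ) ∣ z) : PowDvd p 1 (z : ℚ) := by
  obtain ⟨w, rfl⟩ := h
  obtain ⟨r, hr, h⟩ := intCast hp w
  exact ⟨r, hr, by push_cast; rw [h]; ring⟩

theorem inv_two (hp : p.Prime) (hp2 : p ≠ 2) : PowDvd p 0 (2 : ℚ)⁻¹ :=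
  inv_natCast fun h => hp2 ((Nat.prime_dvd_prime_iff_eq hp Nat.prime_two).1 h)

/-- Wilson's theorem: `(p - 1)! ≡ -1 (mod p)`. -/
theorem factorial_add_one (hp : p.Prime) : PowDvd p 1 ((p - 1).factorial + 1 : ℚ) := by
  have : Fact p.Prime := ⟨hp⟩
  have h : (p : ℤ) ∣ ((p - 1).factorial + 1 : ℤ) := by
    rw [← ZMod.intCast_zmod_eq_zero_iff_dvd]
    push_cast
    rw [ZMod.wilsons_lemma, neg_add_cancel]
  simpa using of_intCast_dvd hp h

end PowDvd

/-! ### Bernoulli numbers and power sums modulo `p ^ 2` -/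

/-- The Bernoulli number `B_n` is `p`-integral for `n ≤ p - 2`: the recursion for `B_n` divides by
`n + 1` only. -/
theorem powDvd_zero_bernoulli {p : ℕ} (hp : p.Prime) {n : ℕ} (hn : n + 2 ≤ p) :
    PowDvd p 0 (bernoulli n) := by
  induction n using Nat.strong_induction_on with
  | _ n ih =>
    refine PowDvd.of_natCast_mul hp (Nat.not_dvd_of_pos_of_lt n.succ_pos (by omega)) ?_
    have h := sum_bernoulli (n + 1)
    rw [Finset.sum_range_succ, Nat.choose_succ_self_right] at h
    rw [← eq_sub_iff_add_eq'] at h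
    rw [h]
    refine PowDvd.sub hp ?_ (PowDvd.sum hp _ fun i hi => ?_)
    · split_ifs
      · simpa using PowDvd.natCast hp 1
      · exact PowDvd.zero hp 0
    · have := Finset.mem_range.1 hi
      exact (PowDvd.natCast hp _).mul_left hp (ih i this (by omega))

/-- `∑_{a<p} a ^ m ≡ p B_m (mod p ^ 2)` for `1 ≤ m ≤ p - 2`, by Faulhaber's formula. -/
theorem powDvd_two_sum_pow_sub {p : ℕ} (hp : p.Prime) {m : ℕ} (hm0 : m ≠ 0) (hm : m + 2 ≤ p) :
    PowDvd p 2 (∑ i ∈ Finset.Icc 1 (p - 1), (i : ℚ) ^ m - p * bernoulli m) := by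
  have hS : ∑ i ∈ Finset.Icc 1 (p - 1), (i : ℚ) ^ m = ∑ i ∈ Finset.range p, (i : ℚ) ^ m := by
    refine Finset.sum_subset (fun i hi => ?_) fun i hi hi' => ?_
    · simp only [Finset.mem_Icc, Finset.mem_range] at *
      omega
    · have : i = 0 := by
        simp only [Finset.mem_Icc, Finset.mem_range] at *
        omega
      simp [this, hm0]
  have hm1 : (m : ℚ) + 1 ≠ 0 := by positivity
  rw [hS, sum_range_pow, Finset.sum_range_succ, Nat.choose_succ_self_right,
    show m + 1 - m = 1 by omega]
  have : bernoulli m * ((m + 1 : ℕ) : ℚ) * (p : ℚ) ^ 1 / (m + 1) = p * bernoulli m := by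
    push_cast
    field_simp
  rw [this, add_sub_cancel_right]
  refine PowDvd.sum hp _ fun i hi => ?_
  have hi := Finset.mem_range.1 hi
  rw [div_eq_mul_inv]
  refine PowDvd.mul_right hp (PowDvd.mul_left hp (PowDvd.mul_right hp
    (powDvd_zero_bernoulli hp (by omega)) (PowDvd.natCast hp _)) ?_) ?_
  · exact (PowDvd.prime_pow hp _).mono hp (by omega)
  · simpa using PowDvd.inv_natCast (Nat.not_dvd_of_pos_of_lt m.succ_pos (by omega : m + 1 < p))

theorem powDvd_one_sum_pow {p : ℕ} (hp : p.Prime) {m : ℕ} (hm0 : m ≠ 0) (hm : m + 2 ≤ p) :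
    PowDvd p 1 (∑ i ∈ Finset.Icc 1 (p - 1), (i : ℚ) ^ m) := by
  have h := ((powDvd_two_sum_pow_sub hp hm0 hm).mono hp one_le_two).add hp
    ((PowDvd.prime_pow hp 1).mul_right hp (powDvd_zero_bernoulli hp hm))
  simpa using h

/-! ### Elementary symmetric functions of `1, …, p - 1` modulo `p ^ 2` -/

/-- The `m`-th elementary symmetric function of `1, …, n`. -/
def esymmIcc (n m : ℕ) : ℚ :=
  ∑ t ∈ (Finset.Icc 1 n).powersetCard m, ∏ i ∈ t, (i : ℚ)

theorem esymmIcc_zero (n : ℕ) : esymmIcc n 0 = 1 := by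
  simp [esymmIcc]

/-- Newton's identities for the integers `1, …, n`. -/
theorem mul_esymmIcc (n m : ℕ) :
    (m : ℚ) * esymmIcc n m = (-1) ^ (m + 1) *
      ∑ a ∈ Finset.HasAntidiagonal.antidiagonal m with a.1 < m,
        (-1) ^ a.1 * esymmIcc n a.1 * ∑ i ∈ Finset.Icc 1 n, (i : ℚ) ^ a.2 := by
  have h := congrArg (MvPolynomial.aeval (fun i : Finset.Icc 1 n => ((i : ℕ) : ℚ)))
    (MvPolynomial.mul_esymm_eq_sum (Finset.Icc 1 n) ℚ m)
  have hE (j : ℕ) : MvPolynomial.aeval (fun i : Finset.Icc 1 n => ((i : ℕ) : ℚ))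
      (MvPolynomial.esymm (Finset.Icc 1 n) ℚ j) = esymmIcc n j := by
    rw [MvPolynomial.aeval_esymm_eq_multiset_esymm, esymmIcc, ← Finset.esymm_map_val]
    congr 1
    exact Multiset.attach_map_val' (Finset.Icc 1 n).val (fun i : ℕ => (i : ℚ))
  have hS (j : ℕ) : MvPolynomial.aeval (fun i : Finset.Icc 1 n => ((i : ℕ) : ℚ))
      (MvPolynomial.psum (Finset.Icc 1 n) ℚ j) = ∑ i ∈ Finset.Icc 1 n, (i : ℚ) ^ j := by
    simp only [MvPolynomial.psum, map_sum, map_pow, MvPolynomial.aeval_X]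
    exact Finset.sum_coe_sort (Finset.Icc 1 n) fun i : ℕ => (i : ℚ) ^ j
  simpa only [map_mul, map_sum, map_pow, map_neg, map_one, map_natCast, hE, hS] using h

theorem powDvd_zero_esymmIcc {p : ℕ} (hp : p.Prime) (n m : ℕ) : PowDvd p 0 (esymmIcc n m) :=
  PowDvd.sum hp _ fun t _ => by simpa using PowDvd.natCast hp (∏ i ∈ t, i)

/-- In Newton's identity for `m e_m` every term contains a power sum whose exponent is between `1`
and `m`, hence is divisible by `p`. -/
theorem powDvd_one_esymmIcc {p : ℕ} (hp : p.Prime) {m : ℕ} (hm0 : m ≠ 0) (hm : m + 2 ≤ p) :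
    PowDvd p 1 (esymmIcc (p - 1) m) := by
  refine PowDvd.of_natCast_mul hp (Nat.not_dvd_of_pos_of_lt (Nat.pos_of_ne_zero hm0)
    (by omega)) ?_
  rw [mul_esymmIcc]
  refine PowDvd.mul_left hp (PowDvd.neg_one_pow hp _)
    (PowDvd.sum hp _ fun a ha => ?_)
  simp only [Finset.mem_filter, Finset.HasAntidiagonal.mem_antidiagonal] at ha
  exact ((PowDvd.neg_one_pow hp _).mul_left hp (powDvd_zero_esymmIcc hp _ _)).mul_left hp
    (powDvd_one_sum_pow hp (by omega) (by omega))

/-- `m e_m ≡ -p B_m (mod p ^ 2)`: in Newton's identity only the power sum itself survives,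
the other terms being products of two multiples of `p`. -/
theorem powDvd_two_mul_esymmIcc {p : ℕ} (hp : p.Prime) {m : ℕ} (hm0 : m ≠ 0) (hm : m + 2 ≤ p)
    (hme : Even m) : PowDvd p 2 (m * esymmIcc (p - 1) m + p * bernoulli m) := by
  have hmem : ((0, m) : ℕ × ℕ) ∈
      (Finset.HasAntidiagonal.antidiagonal m).filter fun a => a.1 < m := by
    simp [Nat.pos_of_ne_zero hm0]
  rw [mul_esymmIcc, ← Finset.add_sum_erase _ _ hmem, hme.add_one.neg_one_pow, esymmIcc_zero,
    mul_add]
  have h1 := (powDvd_two_sum_pow_sub hp hm0 hm).neg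
  have h2 : PowDvd p 2 (∑ a ∈
      ((Finset.HasAntidiagonal.antidiagonal m).filter fun a => a.1 < m).erase (0, m),
      (-1) ^ a.1 * esymmIcc (p - 1) a.1 * ∑ i ∈ Finset.Icc 1 (p - 1), (i : ℚ) ^ a.2) := by
    refine PowDvd.sum hp _ fun a ha => ?_
    simp only [Finset.mem_erase, Finset.mem_filter, Finset.HasAntidiagonal.mem_antidiagonal, ne_eq,
      Prod.ext_iff] at ha
    exact ((PowDvd.neg_one_pow hp _).mul_left hp
      (powDvd_one_esymmIcc hp (by omega) (by omega))).mul hp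
      (powDvd_one_sum_pow hp (by omega) (by omega))
  convert h1.sub hp h2 using 1
  simp
  ring

/-! ### Multiple harmonic sums as elementary symmetric functions -/

/-- A strictly decreasing sequence of length `j` is determined by its set of values, so
`H({1}^j; n)` is the elementary symmetric function of degree `j` of `1, 1/2, …, 1/n`. -/
theorem harmonicOnes_eq_sum_powersetCard (j n : ℕ) :
    harmonicOnes j n = ∑ t ∈ (Finset.Icc 1 n).powersetCard j, ∏ i ∈ t, (i : ℚ)⁻¹ := by
  unfold harmonicOnes multipleHarmonicSum
  have hanti {f : Fin j → ℕ} (hf : f ∈ (Fintype.piFinset fun _ : Fin j => Finset.Icc 1 n).filter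
      fun i => ∀ s t, s < t → i t < i s) : StrictAnti f :=
    fun s t hst => (Finset.mem_filter.1 hf).2 s t hst
  refine Finset.sum_nbij (fun f => Finset.univ.image f) (fun f hf => ?_) (fun f hf g hg h => ?_)
    (fun t ht => ?_) (fun f hf => ?_)
  · rw [Finset.mem_powersetCard, Finset.card_image_of_injective _ (hanti hf).injective]
    refine ⟨fun x hx => ?_, by simp⟩
    obtain ⟨s, -, rfl⟩ := Finset.mem_image.1 hx
    exact Fintype.mem_piFinset.1 (Finset.mem_filter.1 hf).1 s
  · have hf' := (hanti hf).comp (Fin.rev_strictAnti (n := j))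
    have hg' := (hanti hg).comp (Fin.rev_strictAnti (n := j))
    have hr : Set.range f = Set.range g := by
      simpa using congrArg (fun s : Finset ℕ => (s : Set ℕ)) h
    have := (StrictMono.range_inj hf' hg').1 (by
      rw [Fin.rev_surjective.range_comp, Fin.rev_surjective.range_comp, hr])
    exact Fin.rev_surjective.injective_comp_right this
  · obtain ⟨hts, htc⟩ := Finset.mem_powersetCard.1 (Finset.mem_coe.1 ht)
    refine ⟨t.orderEmbOfFin htc ∘ Fin.rev, ?_, ?_⟩
    · rw [Finset.mem_coe, Finset.mem_filter, Fintype.mem_piFinset]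
      refine ⟨fun s => hts (t.orderEmbOfFin_mem htc _), fun a b hab => ?_⟩
      exact (t.orderEmbOfFin htc).strictMono (Fin.rev_strictAnti hab)
    · apply Finset.coe_injective
      rw [Finset.coe_image, Finset.coe_univ, Set.image_univ, Fin.rev_surjective.range_comp,
        Finset.range_orderEmbOfFin]
  · rw [Finset.prod_image (hanti hf).injective.injOn]
    simp

theorem harmonicOnes_eq_zero {j n : ℕ} (h : n < j) : harmonicOnes j n = 0 := by
  rw [harmonicOnes_eq_sum_powersetCard, Finset.powersetCard_eq_empty.2 (by simpa using h),
    Finset.sum_empty]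

theorem natCast_factorial_eq_prod_Icc (n : ℕ) :
    (n.factorial : ℚ) = ∏ i ∈ Finset.Icc 1 n, (i : ℚ) := by
  rw [← Finset.prod_Ico_id_eq_factorial, Finset.Ico_add_one_right_eq_Icc]
  push_cast
  rfl

theorem factorial_mul_prod_one_add_div (n : ℕ) (x : ℚ) :
    (n.factorial : ℚ) * ∏ i ∈ Finset.Icc 1 n, (1 + x / i) = ∏ i ∈ Finset.Icc 1 n, (x + i) := by
  rw [natCast_factorial_eq_prod_Icc, ← Finset.prod_mul_distrib]
  refine Finset.prod_congr rfl fun i hi => ?_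
  have := (Finset.mem_Icc.1 hi).1
  have : (i : ℚ) ≠ 0 := by positivity
  field_simp
  ring

/-- The generating polynomial of the sums `H({1}^j; n)`. -/
theorem prod_one_add_div (n : ℕ) (x : ℚ) :
    ∏ i ∈ Finset.Icc 1 n, (1 + x / i) = ∑ j ∈ Finset.range (n + 1), harmonicOnes j n * x ^ j := by
  rw [Finset.prod_one_add, Finset.sum_powerset, Nat.card_Icc, Nat.add_sub_cancel]
  refine Finset.sum_congr rfl fun j _ => ?_
  rw [harmonicOnes_eq_sum_powersetCard, Finset.sum_mul]
  refine Finset.sum_congr rfl fun t ht => ?_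
  simp only [div_eq_mul_inv, Finset.prod_mul_distrib, Finset.prod_const,
    (Finset.mem_powersetCard.1 ht).2]
  ring

/-- Passing to complements of subsets of `{1, …, n}`. -/
theorem factorial_mul_harmonicOnes {j n : ℕ} (h : j ≤ n) :
    (n.factorial : ℚ) * harmonicOnes j n = esymmIcc n (n - j) := by
  rw [harmonicOnes_eq_sum_powersetCard, esymmIcc, Finset.mul_sum]
  have hc : (Finset.Icc 1 n).card = n := by simp
  refine Finset.sum_nbij' (Finset.Icc 1 n \ ·) (Finset.Icc 1 n \ ·) (fun t ht => ?_)
    (fun t ht => ?_) (fun t ht => ?_) (fun t ht => ?_) (fun t ht => ?_)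
  all_goals obtain ⟨hts, htc⟩ := Finset.mem_powersetCard.1 ht
  · rw [Finset.mem_powersetCard, Finset.card_sdiff_of_subset hts, hc, htc]
    exact ⟨Finset.sdiff_subset, rfl⟩
  · rw [Finset.mem_powersetCard, Finset.card_sdiff_of_subset hts, hc, htc]
    exact ⟨Finset.sdiff_subset, by omega⟩
  · exact Finset.sdiff_sdiff_eq_self hts
  · exact Finset.sdiff_sdiff_eq_self hts
  · have ht0 : ∏ i ∈ t, (i : ℚ) ≠ 0 := Finset.prod_ne_zero_iff.2 fun i hi => by
      have := (Finset.mem_Icc.1 (hts hi)).1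
      positivity
    rw [natCast_factorial_eq_prod_Icc, ← Finset.prod_sdiff hts, Finset.prod_inv_distrib, mul_assoc,
      mul_inv_cancel₀ ht0, mul_one]

/-! ### The reflection `x ↦ -p - x` -/

/-- For odd `p` the polynomial `∑_j H({1}^j; p - 1) x ^ j` is invariant under `x ↦ -p - x`; this
compares the coefficients of `x ^ i`. -/
theorem harmonicOnes_reflection {p : ℕ} (hp : Odd p) (i : ℕ) :
    harmonicOnes i (p - 1) = ∑ j ∈ Finset.range p,
      (-1) ^ j * (j.choose i : ℚ) * (p : ℚ) ^ (j - i) * harmonicOnes j (p - 1) := by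
  have hpos : p - 1 + 1 = p := Nat.sub_add_cancel hp.pos
  have hsymm (x : ℚ) : ∏ i ∈ Finset.Icc 1 (p - 1), (1 + x / i)
      = ∏ i ∈ Finset.Icc 1 (p - 1), (1 + (-(x + p)) / i) := by
    -- both products have the same numerator, as `i ↦ p - i` permutes `1, …, p - 1`
    have h2 (i : ℕ) (hi : i ∈ Finset.Icc 1 (p - 1)) : -(x + p) + i = -(x + (p - i : ℕ)) := by
      have hi := Finset.mem_Icc.1 hi
      rw [Nat.cast_sub (by omega)]
      ring
    refine mul_left_cancel₀ (Nat.cast_ne_zero.2 (p - 1).factorial_ne_zero) ?_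
    rw [factorial_mul_prod_one_add_div, factorial_mul_prod_one_add_div, Finset.prod_congr rfl h2,
      Finset.prod_neg, Nat.card_Icc, Nat.add_sub_cancel, (Nat.Odd.sub_odd hp odd_one).neg_one_pow,
      one_mul]
    refine Finset.prod_nbij' (p - ·) (p - ·) ?_ ?_ ?_ ?_ ?_ <;> intro i hi <;>
      simp only [Finset.mem_Icc] at hi ⊢
    · omega
    · omega
    · omega
    · omega
    · rw [show p - (p - i) = i by omega]
  open Polynomial in
  have hpoly : (∑ j ∈ Finset.range p, C (harmonicOnes j (p - 1)) * X ^ j : ℚ[X])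
      = ∑ j ∈ Finset.range p, C ((-1) ^ j * harmonicOnes j (p - 1)) * (X + C (p : ℚ)) ^ j := by
    refine Polynomial.funext fun x => ?_
    have h := hsymm x
    rw [prod_one_add_div, prod_one_add_div, hpos] at h
    simp only [eval_finsetSum, eval_mul, eval_C, eval_pow, eval_X, eval_add]
    rw [h]
    refine Finset.sum_congr rfl fun j _ => ?_
    rw [neg_pow]
    ring
  have h := congrArg (fun q => Polynomial.coeff q i) hpoly
  simp only [Polynomial.finsetSum_coeff, Polynomial.coeff_C_mul, Polynomial.coeff_X_pow,
    Polynomial.coeff_X_add_C_pow, mul_ite, mul_one, mul_zero, Finset.sum_ite_eq] at h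
  have hi : harmonicOnes i (p - 1)
      = if i ∈ Finset.range p then harmonicOnes i (p - 1) else 0 := by
    split_ifs with hi
    · rfl
    · exact harmonicOnes_eq_zero (by rw [Finset.mem_range] at hi; omega)
  rw [hi, h]
  exact Finset.sum_congr rfl fun j _ => by ring

/-- The complete expansion of the binomial coefficient. The reflection formula makes the terms of
the sum containing the `c_i` cancel. -/
theorem wolstenholmeBinom_eq_sum (k : ℤ) (c : ℕ → ℚ) {p : ℕ} (hp : Odd p) :
    (wolstenholmeBinom k p : ℚ) = ∑ j ∈ Finset.range p,
      wolstenholmeCoeff k c j * (p : ℚ) ^ j * harmonicOnes j (p - 1) := by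
  have hpos : p - 1 + 1 = p := Nat.sub_add_cancel hp.pos
  have hbinom : (wolstenholmeBinom k p : ℚ) = ∑ j ∈ Finset.range p,
      harmonicOnes j (p - 1) * (((k : ℚ) - 1) * p) ^ j := by
    have h := congrArg (Int.cast : ℤ → ℚ)
      (Ring.descPochhammer_eq_factorial_smul_choose (k * (p : ℤ) - 1) (p - 1))
    rw [← Polynomial.eval_eq_smeval, descPochhammer_eval_eq_prod_range, nsmul_eq_mul] at h
    push_cast at h
    have hgen := prod_one_add_div (p - 1) (((k : ℚ) - 1) * p)
    rw [hpos] at hgen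
    rw [← hgen]
    refine mul_left_cancel₀ (Nat.cast_ne_zero.2 (p - 1).factorial_ne_zero) ?_
    rw [factorial_mul_prod_one_add_div, wolstenholmeBinom, ← h]
    -- `k p - 1 - j = (k - 1) p + (p - 1 - j)`
    refine Finset.prod_nbij' (p - 1 - ·) (p - 1 - ·) ?_ ?_ ?_ ?_ ?_ <;> intro i hi <;>
      simp only [Finset.mem_Icc, Finset.mem_range] at hi ⊢
    · omega
    · omega
    · omega
    · omega
    · rw [Nat.cast_sub (by omega), Nat.cast_sub (by omega)]
      push_cast
      ring
  have hcancel : ∑ j ∈ Finset.range p, (c j + (-1) ^ (j + 1) *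
      ∑ i ∈ Finset.range (j + 1), (j.choose i : ℚ) * c i) * (p : ℚ) ^ j * harmonicOnes j (p - 1)
      = 0 := by
    have h1 : ∑ i ∈ Finset.range p, c i * (p : ℚ) ^ i * harmonicOnes i (p - 1)
        = ∑ j ∈ Finset.range p, ∑ i ∈ Finset.range p,
          (-1) ^ j * ((j.choose i : ℚ) * c i) * (p : ℚ) ^ j * harmonicOnes j (p - 1) := by
      rw [Finset.sum_comm]
      refine Finset.sum_congr rfl fun i _ => ?_
      rw [harmonicOnes_reflection hp i, Finset.mul_sum]
      refine Finset.sum_congr rfl fun j _ => ?_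
      rcases lt_or_ge j i with hji | hij
      · simp [Nat.choose_eq_zero_of_lt hji]
      · obtain ⟨d, rfl⟩ := Nat.exists_eq_add_of_le hij
        rw [Nat.add_sub_cancel_left]
        ring
    have h2 : ∑ j ∈ Finset.range p, ∑ i ∈ Finset.range p,
          (-1) ^ j * ((j.choose i : ℚ) * c i) * (p : ℚ) ^ j * harmonicOnes j (p - 1)
        = ∑ j ∈ Finset.range p, ((-1) ^ j *
          ∑ i ∈ Finset.range (j + 1), (j.choose i : ℚ) * c i) * (p : ℚ) ^ j
            * harmonicOnes j (p - 1) := by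
      refine Finset.sum_congr rfl fun j hj => ?_
      have hj := Finset.mem_range.1 hj
      have : ∑ i ∈ Finset.range (j + 1), (j.choose i : ℚ) * c i
          = ∑ i ∈ Finset.range p, (j.choose i : ℚ) * c i := by
        refine Finset.sum_subset (Finset.range_mono (by omega)) fun i _ hi => ?_
        rw [Finset.mem_range] at hi
        simp [Nat.choose_eq_zero_of_lt (by omega : j < i)]
      rw [this, Finset.mul_sum, Finset.sum_mul, Finset.sum_mul]
    rw [← sub_eq_zero.2 (h1.trans h2), ← Finset.sum_sub_distrib]
    exact Finset.sum_congr rfl fun j _ => by ring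
  rw [hbinom, ← add_zero (∑ j ∈ _, _), ← hcancel, ← Finset.sum_add_distrib]
  refine Finset.sum_congr rfl fun j _ => ?_
  rw [wolstenholmeCoeff, mul_pow]
  ring

/-! ### Congruences for the sums `H({1}^n; p - 1)` -/

theorem not_dvd_factorial_pred {p : ℕ} (hp : p.Prime) : ¬ p ∣ (p - 1).factorial := by
  rw [hp.dvd_factorial]
  have := hp.pos
  omega

theorem powDvd_zero_harmonicOnes {p : ℕ} (hp : p.Prime) (n : ℕ) :
    PowDvd p 0 (harmonicOnes n (p - 1)) := by
  rcases lt_or_ge (p - 1) n with h | h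
  · rw [harmonicOnes_eq_zero h]
    exact PowDvd.zero hp 0
  · refine PowDvd.of_natCast_mul hp (not_dvd_factorial_pred hp) ?_
    rw [factorial_mul_harmonicOnes h]
    exact powDvd_zero_esymmIcc hp _ _

theorem powDvd_one_harmonicOnes {p : ℕ} (hp : p.Prime) {n : ℕ} (hn0 : n ≠ 0) (hn : n + 2 ≤ p) :
    PowDvd p 1 (harmonicOnes n (p - 1)) := by
  refine PowDvd.of_natCast_mul hp (not_dvd_factorial_pred hp) ?_
  rw [factorial_mul_harmonicOnes (by omega)]
  exact powDvd_one_esymmIcc hp (by omega) (by omega)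

theorem powDvd_one_harmonicOnes_pred {p : ℕ} (hp : p.Prime) :
    PowDvd p 1 (harmonicOnes (p - 1) (p - 1) + 1) := by
  refine PowDvd.of_natCast_mul hp (not_dvd_factorial_pred hp) ?_
  rw [mul_add, factorial_mul_harmonicOnes le_rfl, Nat.sub_self, esymmIcc_zero, mul_one, add_comm]
  exact PowDvd.factorial_add_one hp

/-- `H({1}^n; p - 1) ≡ -p B_{p-1-n} / (n + 1) (mod p ^ 2)` for even `n` with `2 ≤ n ≤ p - 3`. -/
theorem powDvd_two_harmonicOnes_even {p : ℕ} (hp : p.Prime) (hp2 : p ≠ 2) {n : ℕ} (hne : Even n)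
    (hn0 : n ≠ 0) (hn : n + 3 ≤ p) :
    PowDvd p 2 (harmonicOnes n (p - 1) + p * bernoulli (p - 1 - n) / (n + 1)) := by
  have hpodd : Odd p := hp.odd_of_ne_two hp2
  have hn1 : ((n + 1 : ℕ) : ℚ) ≠ 0 := by positivity
  refine PowDvd.of_natCast_mul hp (Nat.not_dvd_of_pos_of_lt n.succ_pos (by omega)) ?_
  have hm : Even (p - 1 - n) := by grind
  have h1 := powDvd_two_mul_esymmIcc hp (m := p - 1 - n) (by omega) (by omega) hm
  have hH := powDvd_one_harmonicOnes hp hn0 (by omega)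
  have h2 := ((PowDvd.natCast hp (p - 1 - n)).mul_left hp (PowDvd.factorial_add_one hp)).mul hp hH
  have h3 := (PowDvd.prime_pow hp 1).mul hp hH
  rw [← factorial_mul_harmonicOnes (by omega)] at h1
  -- replace `(p - 1)!` by `-1` and `p - 1 - n` by `-(n + 1)`
  convert (h1.sub hp h2).add hp h3 using 1
  have hcast : ((p - 1 - n : ℕ) : ℚ) = p - (n + 1) := by
    rw [Nat.sub_sub, Nat.cast_sub (by omega)]
    push_cast
    ring
  rw [hcast]
  push_cast at hn1 ⊢
  field_simp
  ring

/-- The reflection formula for odd `n`, where it expresses `H({1}^n; p - 1)` through the sums of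
larger depth. -/
theorem two_mul_harmonicOnes_odd {p : ℕ} (hpodd : Odd p) {n : ℕ} (hno : Odd n)
    (hn : n + 2 ≤ p) :
    2 * harmonicOnes n (p - 1) = (n + 1) * p * harmonicOnes (n + 1) (p - 1)
      + ∑ j ∈ Finset.Ico (n + 2) p,
        (-1) ^ j * (j.choose n : ℚ) * (p : ℚ) ^ (j - n) * harmonicOnes j (p - 1) := by
  have h := harmonicOnes_reflection hpodd n
  have h0 : ∑ j ∈ Finset.range n,
      (-1) ^ j * (j.choose n : ℚ) * (p : ℚ) ^ (j - n) * harmonicOnes j (p - 1) = 0 :=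
    Finset.sum_eq_zero fun j hj => by simp [Nat.choose_eq_zero_of_lt (Finset.mem_range.1 hj)]
  rw [← Finset.sum_range_add_sum_Ico _ (by omega : n ≤ p), h0, zero_add,
    Finset.sum_eq_sum_Ico_succ_bot (by omega), Finset.sum_eq_sum_Ico_succ_bot (by omega),
    Nat.choose_self, Nat.choose_succ_self_right, hno.neg_one_pow, hno.add_one.neg_one_pow,
    Nat.sub_self, Nat.add_sub_cancel_left] at h
  push_cast at h
  linear_combination h

/-- In the reflection formula the terms beyond `n + 1` are divisible by `p ^ 3`; the one of index
`n + 2` because its harmonic sum still contributes a factor `p`. -/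
theorem powDvd_three_harmonicOnes_odd {p : ℕ} (hp : p.Prime) (hp2 : p ≠ 2) {n : ℕ} (hno : Odd n)
    (hn : n + 4 ≤ p) :
    PowDvd p 3 (harmonicOnes n (p - 1) - (n + 1) / 2 * p * harmonicOnes (n + 1) (p - 1)) := by
  have h := two_mul_harmonicOnes_odd (hp.odd_of_ne_two hp2) hno (by omega)
  have hrest : PowDvd p 3 (∑ j ∈ Finset.Ico (n + 2) p,
      (-1) ^ j * (j.choose n : ℚ) * (p : ℚ) ^ (j - n) * harmonicOnes j (p - 1)) := by
    refine PowDvd.sum hp _ fun j hj => ?_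
    have hj := Finset.mem_Ico.1 hj
    rw [mul_assoc]
    refine PowDvd.mul_left hp ((PowDvd.neg_one_pow hp j).mul_left hp (PowDvd.natCast hp _)) ?_
    rcases hj.1.eq_or_lt with rfl | hlt
    · rw [Nat.add_sub_cancel_left]
      exact (PowDvd.prime_pow hp 2).mul hp (powDvd_one_harmonicOnes hp (by omega) (by omega))
    · exact ((PowDvd.prime_pow hp _).mono hp (by omega)).mul_right hp
        (powDvd_zero_harmonicOnes hp j)
  convert (PowDvd.inv_two hp hp2).mul_left hp hrest using 1
  linear_combination h / 2

/-- The reflection formula for `n = p - 2`, which has no terms beyond `n + 1 = p - 1`. -/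
theorem powDvd_two_harmonicOnes_sub_two {p : ℕ} (hp : p.Prime) (hp2 : p ≠ 2) :
    PowDvd p 2 (harmonicOnes (p - 2) (p - 1) - p / 2) := by
  have hpodd := hp.odd_of_ne_two hp2
  have h2 := hp.two_le
  obtain ⟨n, rfl⟩ := Nat.exists_eq_add_of_le' h2
  have h := two_mul_harmonicOnes_odd hpodd (n := n) (by grind) le_rfl
  rw [Finset.Ico_self, Finset.sum_empty, add_zero] at h
  have hw := (PowDvd.prime_pow hp 1).mul hp (powDvd_one_harmonicOnes_pred hp)
  have hH := (PowDvd.prime_pow hp 2).mul_right hp (powDvd_zero_harmonicOnes hp (n + 1))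
  convert (PowDvd.inv_two hp hp2).mul_left hp (hH.sub hp hw) using 1
  simp only [Nat.add_sub_cancel, show n + 2 - 1 = n + 1 by omega] at h ⊢
  push_cast at h ⊢
  linear_combination h / 2

/-! ### The truncation error -/

theorem powDvd_zero_wolstenholmeCoeff {p : ℕ} (hp : p.Prime) (k : ℤ) {c : ℕ → ℚ}
    (hc : ∀ i, ¬ p ∣ (c i).den) (j : ℕ) : PowDvd p 0 (wolstenholmeCoeff k c j) := by
  refine PowDvd.add hp (PowDvd.add hp ?_ (.of_den (hc j)))
    ((PowDvd.neg_one_pow hp _).mul_left hp (PowDvd.sum hp _ fun i _ =>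
      (PowDvd.natCast hp _).mul_left hp (.of_den (hc i))))
  exact_mod_cast PowDvd.intCast hp ((k - 1) ^ j)

theorem wolstenholmeError_eq_sum (k : ℤ) (c : ℕ → ℚ) {p N : ℕ} (hp : Odd p) (h : N + 1 ≤ p) :
    wolstenholmeError k c p N = ∑ j ∈ Finset.Ico (N + 1) p,
      wolstenholmeCoeff k c j * (p : ℚ) ^ j * harmonicOnes j (p - 1) := by
  rw [wolstenholmeError, wolstenholmeBinom_eq_sum k c hp, wolstenholmeSum,
    Finset.sum_Ico_eq_sub _ h]

theorem wolstenholmeError_eq_zero (k : ℤ) (c : ℕ → ℚ) {p N : ℕ} (hp : Odd p) (h : p ≤ N + 1) :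
    wolstenholmeError k c p N = 0 := by
  rw [wolstenholmeError, wolstenholmeBinom_eq_sum k c hp, wolstenholmeSum, sub_eq_zero]
  refine Finset.sum_subset (Finset.range_mono h) fun j _ hj => ?_
  rw [Finset.mem_range] at hj
  rw [harmonicOnes_eq_zero (by have := hp.pos; omega), mul_zero]

/-- The terms of the expansion from the index `m` on are divisible by `p ^ (m + 1)`, as long as `m`
is at most `p - 2`: the term of index `m` gains a factor `p` from its harmonic sum. -/
theorem powDvd_sum_Ico {p : ℕ} (hp : p.Prime) (k : ℤ) {c : ℕ → ℚ}
    (hc : ∀ i, ¬ p ∣ (c i).den) {m : ℕ} (hm0 : m ≠ 0) (hm : m + 2 ≤ p) :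
    PowDvd p (m + 1) (∑ j ∈ Finset.Ico m p,
      wolstenholmeCoeff k c j * (p : ℚ) ^ j * harmonicOnes j (p - 1)) := by
  refine PowDvd.sum hp _ fun j hj => ?_
  have hj := Finset.mem_Ico.1 hj
  rw [mul_assoc]
  refine PowDvd.mul_left hp (powDvd_zero_wolstenholmeCoeff hp k hc j) ?_
  rcases hj.1.eq_or_lt with rfl | hlt
  · exact (PowDvd.prime_pow hp _).mul hp (powDvd_one_harmonicOnes hp hm0 hm)
  · exact ((PowDvd.prime_pow hp j).mono hp hlt).mul_right hp (powDvd_zero_harmonicOnes hp j)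

section

variable {p : ℕ} (k : ℤ) {c : ℕ → ℚ} {N : ℕ}

theorem wolstenholmeError_even (hp : p.Prime) (hp2 : p ≠ 2) (hc : ∀ i, ¬ p ∣ (c i).den)
    (hN : N + 4 ≤ p) (hNe : Even N) :
    PowDvd p (N + 4) (wolstenholmeError k c p N -
      -bernoulli (p - 3 - N) / ((N : ℚ) + 3)
          * (((N : ℚ) + 2) / 2 * wolstenholmeCoeff k c (N + 1) + wolstenholmeCoeff k c (N + 2))
          * (p : ℚ) ^ (N + 3)) := by
  have hpodd := hp.odd_of_ne_two hp2
  have hN5 : N + 5 ≤ p := by grind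
  have hb := powDvd_zero_wolstenholmeCoeff hp k hc
  have hX := powDvd_three_harmonicOnes_odd hp hp2 (n := N + 1) hNe.add_one (by omega)
  have hY := powDvd_two_harmonicOnes_even hp hp2 (n := N + 2) (by grind) (by omega) (by omega)
  have hrest := powDvd_sum_Ico hp k hc (m := N + 3) (by omega) (by omega)
  have hN2 : PowDvd p 0 (((N : ℚ) + 2) / 2) := by
    simpa [div_eq_mul_inv] using (PowDvd.natCast hp (N + 2)).mul_left hp (PowDvd.inv_two hp hp2)
  have h1 := ((hb (N + 1)).mul_left hp (PowDvd.prime_pow hp (N + 1))).mul hp hX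
  have h2 := (((hN2.mul_left hp (hb (N + 1))).add hp (hb (N + 2))).mul_left hp
    (PowDvd.prime_pow hp (N + 2))).mul hp hY
  rw [wolstenholmeError_eq_sum k c hpodd (by omega), Finset.sum_eq_sum_Ico_succ_bot (by omega),
    Finset.sum_eq_sum_Ico_succ_bot (by omega)]
  convert (h1.add hp h2).add hp hrest using 1
  rw [show p - 1 - (N + 2) = p - 3 - N by omega]
  push_cast
  ring

theorem wolstenholmeError_odd (hp : p.Prime) (hp2 : p ≠ 2) (hc : ∀ i, ¬ p ∣ (c i).den)
    (hN : N + 4 ≤ p) (hNo : Odd N) :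
    PowDvd p (N + 3) (wolstenholmeError k c p N -
      -bernoulli (p - 2 - N) / ((N : ℚ) + 2)
          * wolstenholmeCoeff k c (N + 1) * (p : ℚ) ^ (N + 2)) := by
  have hY := powDvd_two_harmonicOnes_even hp hp2 (n := N + 1) hNo.add_one (by omega) (by omega)
  have hrest := powDvd_sum_Ico hp k hc (m := N + 2) (by omega) (by omega)
  have h1 := ((powDvd_zero_wolstenholmeCoeff hp k hc (N + 1)).mul_left hp
    (PowDvd.prime_pow hp (N + 1))).mul hp hY
  rw [wolstenholmeError_eq_sum k c (hp.odd_of_ne_two hp2) (by omega),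
    Finset.sum_eq_sum_Ico_succ_bot (by omega)]
  convert h1.add hp hrest using 1
  rw [show p - 1 - (N + 1) = p - 2 - N by omega]
  push_cast
  ring

theorem wolstenholmeError_of_add_three_eq (hp : p.Prime) (hp2 : p ≠ 2)
    (hc : ∀ i, ¬ p ∣ (c i).den) (hN : N + 3 = p) :
    PowDvd p (N + 3) (wolstenholmeError k c p N -
      (wolstenholmeCoeff k c (N + 1) / 2 - wolstenholmeCoeff k c (N + 2)) * (p : ℚ) ^ (N + 2)) := by
  have hb := powDvd_zero_wolstenholmeCoeff hp k hc
  have h1 := ((hb (N + 1)).mul_left hp (PowDvd.prime_pow hp (N + 1))).mul hp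
    (powDvd_two_harmonicOnes_sub_two hp hp2)
  have h2 := ((hb (N + 2)).mul_left hp (PowDvd.prime_pow hp (N + 2))).mul hp
    (powDvd_one_harmonicOnes_pred hp)
  rw [wolstenholmeError_eq_sum k c (hp.odd_of_ne_two hp2) (by omega),
    Finset.sum_eq_sum_Ico_succ_bot (by omega), Finset.sum_eq_sum_Ico_succ_bot (by omega),
    Finset.Ico_eq_empty (by omega), Finset.sum_empty]
  convert h1.add hp h2 using 1
  rw [show p - 2 = N + 1 by omega, show p - 1 = N + 2 by omega]
  ring

theorem wolstenholmeError_of_add_two_eq (hp : p.Prime) (hp2 : p ≠ 2)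
    (hc : ∀ i, ¬ p ∣ (c i).den) (hN : N + 2 = p) :
    PowDvd p (N + 2) (wolstenholmeError k c p N -
      -wolstenholmeCoeff k c (N + 1) * (p : ℚ) ^ (N + 1)) := by
  have h := ((powDvd_zero_wolstenholmeCoeff hp k hc (N + 1)).mul_left hp
    (PowDvd.prime_pow hp (N + 1))).mul hp (powDvd_one_harmonicOnes_pred hp)
  rw [wolstenholmeError_eq_sum k c (hp.odd_of_ne_two hp2) (by omega),
    Finset.sum_eq_sum_Ico_succ_bot (by omega), Finset.Ico_eq_empty (by omega),
    Finset.sum_empty]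
  convert h using 1
  rw [show p - 1 = N + 1 by omega]
  ring

end

theorem theorem3p3 (k : ℤ) (c : ℕ → ℚ) (p : ℕ) (hp : p.Prime) (hp2 : p ≠ 2)
    (hc : ∀ i, ¬ p ∣ (c i).den) (N : ℕ) :
    -- explicit forms of the truncation error
    (N + 4 ≤ p → Even N →
      RatModPow p (N + 4) (wolstenholmeError k c p N)
        (-bernoulli (p - 3 - N) / ((N : ℚ) + 3)
          * (((N : ℚ) + 2) / 2 * wolstenholmeCoeff k c (N + 1) + wolstenholmeCoeff k c (N + 2))
          * (p : ℚ) ^ (N + 3))) ∧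
    (N + 4 ≤ p → Odd N →
      RatModPow p (N + 3) (wolstenholmeError k c p N)
        (-bernoulli (p - 2 - N) / ((N : ℚ) + 2)
          * wolstenholmeCoeff k c (N + 1) * (p : ℚ) ^ (N + 2))) ∧
    (N + 3 = p →
      RatModPow p (N + 3) (wolstenholmeError k c p N)
        ((wolstenholmeCoeff k c (N + 1) / 2 - wolstenholmeCoeff k c (N + 2))
          * (p : ℚ) ^ (N + 2))) ∧
    (N + 2 = p →
      RatModPow p (N + 2) (wolstenholmeError k c p N)
        (-wolstenholmeCoeff k c (N + 1) * (p : ℚ) ^ (N + 1))) ∧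
    (p ≤ N + 1 → wolstenholmeError k c p N = 0) ∧
    -- the resulting congruences for the binomial coefficient
    (N + 4 ≤ p → Even N →
      RatModPow p (N + 3) (wolstenholmeBinom k p : ℚ) (wolstenholmeSum k c p N)) ∧
    (N + 4 ≤ p → Odd N →
      RatModPow p (N + 2) (wolstenholmeBinom k p : ℚ) (wolstenholmeSum k c p N)) ∧
    (N + 3 = p →
      RatModPow p (N + 2) (wolstenholmeBinom k p : ℚ) (wolstenholmeSum k c p N)) ∧
    (N + 2 = p →
      RatModPow p (N + 1) (wolstenholmeBinom k p : ℚ) (wolstenholmeSum k c p N)) ∧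
    (p ≤ N + 1 → (wolstenholmeBinom k p : ℚ) = wolstenholmeSum k c p N) := by
  have hpodd := hp.odd_of_ne_two hp2
  have hb := powDvd_zero_wolstenholmeCoeff hp k hc
  -- the congruence for the binomial coefficient, when the main term of the error is known
  have weaken {m : ℕ} {y : ℚ} (h : PowDvd p (m + 1) (wolstenholmeError k c p N - y * (p : ℚ) ^ m))
      (hy : PowDvd p 0 y) :
      RatModPow p m (wolstenholmeBinom k p : ℚ) (wolstenholmeSum k c p N) := by
    have := (h.mono hp m.le_succ).add hp (hy.mul_left hp (PowDvd.prime_pow hp m))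
    rwa [sub_add_cancel] at this
  have hinv {n : ℕ} (hn : n + 1 < p) : PowDvd p 0 ((n + 1 : ℕ) : ℚ)⁻¹ :=
    PowDvd.inv_natCast (Nat.not_dvd_of_pos_of_lt n.succ_pos hn)
  refine ⟨fun h => wolstenholmeError_even k hp hp2 hc h,
    fun h => wolstenholmeError_odd k hp hp2 hc h,
    wolstenholmeError_of_add_three_eq k hp hp2 hc, wolstenholmeError_of_add_two_eq k hp hp2 hc,
    wolstenholmeError_eq_zero k c hpodd, fun h he => ?_, fun h ho => ?_, fun h => ?_, fun h => ?_,
    fun h => sub_eq_zero.1 (wolstenholmeError_eq_zero k c hpodd h)⟩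
  · refine weaken (wolstenholmeError_even k hp hp2 hc h he) ?_
    have h3 : PowDvd p 0 ((N : ℚ) + 3)⁻¹ := mod_cast hinv (n := N + 2) (by omega)
    have h2 : PowDvd p 0 ((N : ℚ) + 2) := mod_cast PowDvd.natCast hp (N + 2)
    rw [div_eq_mul_inv, div_eq_mul_inv]
    exact ((powDvd_zero_bernoulli hp (by omega)).neg.mul_left hp h3).mul_left hp
      (((h2.mul_left hp (PowDvd.inv_two hp hp2)).mul_left hp (hb _)).add hp (hb _))
  · refine weaken (wolstenholmeError_odd k hp hp2 hc h ho) ?_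
    have h2 : PowDvd p 0 ((N : ℚ) + 2)⁻¹ := mod_cast hinv (n := N + 1) (by omega)
    rw [div_eq_mul_inv]
    exact ((powDvd_zero_bernoulli hp (by omega)).neg.mul_left hp h2).mul_left hp (hb _)
  · refine weaken (wolstenholmeError_of_add_three_eq k hp hp2 hc h) ?_
    rw [div_eq_mul_inv]
    exact ((hb _).mul_right hp (PowDvd.inv_two hp hp2)).sub hp (hb _)
  · exact weaken (wolstenholmeError_of_add_two_eq k hp hp2 hc h) (hb _).neg
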